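/- **Setting.** Let $\mathbb X=(X,\tau)$ be a topological space and let $\Omega_0\subseteq\tau$ be a viable base, i.e. a base of $\tau$ that is closed under finite unions and finite intersections (so $\emptyset,X\in\Omega_0$). Let $\mathbb D=(D,\sqsubseteq)$ be a bc-domain, i.e. a pointed continuous directed-complete poset in which every bounded subset has a join, equipped with its Scott topology, and let $D_0\subseteq D$ be a basis of $\mathbb D$: for every $x\in D$ the set $\{a\in D_0: a\ll x\}$ is directed with join $x$, where $\ll$ is the way-below relation. Write $\mathord{\Uparrow} b=\{d: b\ll d\}$. Let $\hat{\mathbb X}_{\Omega_0}=\mathrm{pt}(\mathrm{Idl}(\Omega_0))$ be the spectral compactification: its points are the completely prime filters of the complete lattice $\mathrm{Idl}(\Omega_0)$ of ideals of $(\Omega_0,\subseteq)$, and its open sets are the sets $\mathcal O_I=\{y: I\in y\}$ with $I\in\mathrm{Idl}(\Omega_0)$. For $W\in\Omega_0$ let $\mathord{\downarrow}W=\{U\in\Omega_0:U\subseteq W\}$. Let $\iota:X\to\hat{\mathbb X}_{\Omega_0}$, $\iota(x)=\{I: x\in\bigcup I\}$. Let $[\hat{\mathbb X}_{\Omega_0}\to\mathbb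 D]$ be the set of continuous functions with the pointwise order. For a set $O$ and $b\in D$ let $b\chi_O$ be the function with value $b$ on $O$ and $\bot$ off $O$. A finite family $(b_i\chi_{O_i})_{i\in I}$ is consistent if for every $J\subseteq I$ with $\bigcap_{j\in J}O_j\ne\emptyset$ the set $\{b_j: j\in J\}$ has an upper bound; then its join $\bigvee_{i\in I} b_i\chi_{O_i}$ exists, pointwise. Let $\mathbb B_{\mathrm{abs}}$ be the set of all functions $X\to D$ that are joins of consistent finite families $(b_i\chi_{O_i})$ with $O_i\in\Omega_0$, $b_i\in D_0$, and let $\hat{\mathbb B}\subseteq[\hat{\mathbb X}_{\Omega_0}\to\mathbb D]$ be the set of all joins of consistent finite families $(b_i\chi_{\mathcal O_{\downarrow W_i}})$ with $W_i\in\Omega_0$, $b_i\in D_0$. On $\mathbb B_{\mathrm{abs}}$ define $$\bigvee_{i\in I}b_i\chi_{O_i}\prec g\iff\forall i\in I:\ O_i\subseteq g^{-1}(\mathord{\Uparrow} b_i).$$ An abstract basis is a set $B$ with a transitive relation $\prec$ such that whenever $A\subseteq B$ is finite and $a\prec x$ for all $a\in A$, there is $y\in B$ with $a\prec y$ for all $a\in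 A$ and $y\prec x$. Its rounded ideal completion is the set of all $I\subseteq B$ such that $x\prec y\in I$ implies $x\in I$, and every finite $A\subseteq I$ (including $A=\emptyset$) admits $y\in I$ with $a\prec y$ for all $a\in A$; it is ordered by inclusion. **Theorem.** The relation $\prec$ is well defined (it does not depend on the chosen representation of the left-hand side), and $(\mathbb B_{\mathrm{abs}},\prec)$ is an abstract basis. The poset $[\hat{\mathbb X}_{\Omega_0}\to\mathbb D]$ is a domain (a pointed continuous dcpo) with basis $\hat{\mathbb B}$. The map $\gamma(f)=f\circ\iota$ is a bijection $\hat{\mathbb B}\to\mathbb B_{\mathrm{abs}}$ with $f\ll g\iff\gamma(f)\prec\gamma(g)$ for all $f,g\in\hat{\mathbb B}$, where $\ll$ is the way-below relation of $[\hat{\mathbb X}_{\Omega_0}\to\mathbb D]$. Finally, the rounded ideal completion $\mathcal W$ of $(\mathbb B_{\mathrm{abs}},\prec)$ is order isomorphic to $[\hat{\mathbb X}_{\Omega_0}\to\mathbb D]$, via an isomorphism that sends each rounded ideal $I$ to the join of $\{f\in\hat{\mathbb B}:\gamma(f)\in I\}$. -/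

import Mathlib

namespace FunDom

/-! ### Domains -/

/-- The way-below relation `x ≪ y`. -/
def WayBelow {α : Type*} [Preorder α] (x y : α) : Prop :=
  ∀ A : Set α, A.Nonempty → DirectedOn (· ≤ ·) A → ∀ s, IsLUB A s → y ≤ s → ∃ d ∈ A, x ≤ d

/-- Directed-completeness: every (non-empty) directed subset has a join. -/
def IsDcpo (α : Type*) [Preorder α] : Prop :=
  ∀ A : Set α, A.Nonempty → DirectedOn (· ≤ ·) A → ∃ s, IsLUB A s

/-- `B` is a (domain-theoretic) basis: for every `x`, the set of elements of `B` way below `x`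
is directed (in particular non-empty) and has join `x`. -/
def IsDomBasis {α : Type*} [Preorder α] (B : Set α) : Prop :=
  ∀ x : α, ({a | WayBelow a x} ∩ B).Nonempty ∧
    DirectedOn (· ≤ ·) ({a | WayBelow a x} ∩ B) ∧ IsLUB ({a | WayBelow a x} ∩ B) x

/-- A domain is a pointed continuous dcpo. -/
structure IsContDomain (α : Type*) [Preorder α] : Prop where
  pointed : ∃ b : α, IsBot b
  dcpo : IsDcpo α
  continuous : ∃ B : Set α, IsDomBasis B

/-- A bc-domain is a domain in which every bounded subset has a join. -/
structure IsBCDomain (α : Type*) [Preorder α] : Prop extends IsContDomain α where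
  boundedComplete : ∀ A : Set α, BddAbove A → ∃ s, IsLUB A s

/-! ### Abstract bases and their rounded ideal completion -/

/-- `(B, r)` is an abstract basis: `r` is transitive and has the interpolation property. -/
structure IsAbstractBasis {B : Type*} (r : B → B → Prop) : Prop where
  trans : ∀ x y z, r x y → r y z → r x z
  interpolation : ∀ (A : Set B) (x : B), A.Finite → (∀ a ∈ A, r a x) →
    ∃ y, (∀ a ∈ A, r a y) ∧ r y x

/-- A rounded ideal of `(B, r)`: a lower set for `r` which is directed for `r`, i.e. each of its
finite subsets (the empty one included) has an `r`-upper bound in it. -/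
structure RoundedIdeal {B : Type*} (r : B → B → Prop) where
  carrier : Set B
  lower : ∀ x y, r x y → y ∈ carrier → x ∈ carrier
  directed : ∀ A : Set B, A.Finite → A ⊆ carrier → ∃ y ∈ carrier, ∀ a ∈ A, r a y

theorem RoundedIdeal.carrier_injective {B : Type*} {r : B → B → Prop} :
    Function.Injective (RoundedIdeal.carrier : RoundedIdeal r → Set B) := by
  rintro ⟨I, _, _⟩ ⟨J, _, _⟩ h
  cases h
  rfl

/-- The rounded ideal completion: rounded ideals ordered by inclusion. -/
instance {B : Type*} (r : B → B → Prop) : PartialOrder (RoundedIdeal r) :=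
  PartialOrder.lift RoundedIdeal.carrier RoundedIdeal.carrier_injective

/-! ### The spectral compactification -/

/-- A viable base: a ring of open sets (closed under finite unions and finite intersections,
the empty ones included) which is a base of the topology. -/
structure IsViableBase {X : Type*} [TopologicalSpace X] (Ω₀ : Set (Set X)) : Prop where
  empty_mem : ∅ ∈ Ω₀
  univ_mem : Set.univ ∈ Ω₀
  union_mem : ∀ U ∈ Ω₀, ∀ V ∈ Ω₀, U ∪ V ∈ Ω₀
  inter_mem : ∀ U ∈ Ω₀, ∀ V ∈ Ω₀, U ∩ V ∈ Ω₀
  isBase : TopologicalSpace.IsTopologicalBasis Ω₀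

/-- The points of `L`: completely prime filters. -/
structure Pt (L : Type*) [PartialOrder L] extends Order.PFilter L where
  completelyPrime : ∀ (A : Set L) (s : L), IsLUB A s → s ∈ toPFilter → ∃ a ∈ A, a ∈ toPFilter

/-- The set `𝒪_u` of all points containing `u`. -/
def hullOpen {L : Type*} [PartialOrder L] (u : L) : Set (Pt L) :=
  {y | u ∈ y.toPFilter}

/-- The hull-kernel topology. On a complete lattice the sets `𝒪_u` are already closed under
finite intersections and arbitrary unions, so they are exactly the open sets. -/
instance {L : Type*} [PartialOrder L] : TopologicalSpace (Pt L) :=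
  TopologicalSpace.generateFrom (Set.range hullOpen)

/-- The spectral compactification `pt (Idl Ω₀)`, where `Ω₀` is ordered by inclusion. -/
abbrev Spect {X : Type*} (Ω₀ : Set (Set X)) : Type _ := Pt (Order.Ideal Ω₀)

/-- The union of an ideal of open sets. -/
def idealUnion {X : Type*} {Ω₀ : Set (Set X)} (I : Order.Ideal Ω₀) : Set X :=
  {x | ∃ O ∈ I, x ∈ (O : Set X)}

/-- The map `ι`, sending `x` to the completely prime filter of the ideals `I` with `x ∈ ⋃ I`. -/
def iota {X : Type*} [TopologicalSpace X] {Ω₀ : Set (Set X)} (hΩ : IsViableBase Ω₀) (x : X) :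
    Spect Ω₀ where
  toPFilter := Order.IsPFilter.toPFilter (F := {I : Order.Ideal Ω₀ | x ∈ idealUnion I}) <| by
    refine Order.IsPFilter.of_def ?_ ?_ ?_
    · exact ⟨Order.Ideal.principal ⟨Set.univ, hΩ.univ_mem⟩,
        ⟨Set.univ, hΩ.univ_mem⟩, Order.Ideal.mem_principal_self, Set.mem_univ x⟩
    · rintro I ⟨O, hO, hx⟩ J ⟨P, hP, hx'⟩
      have hmem := hΩ.inter_mem O O.2 P P.2
      refine ⟨Order.Ideal.principal ⟨(O : Set X) ∩ P, hmem⟩,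
        ⟨_, Order.Ideal.mem_principal_self, hx, hx'⟩, ?_, ?_⟩
      · exact Order.Ideal.principal_le_iff.2
          (I.lower (show (⟨(O : Set X) ∩ P, hmem⟩ : Ω₀) ≤ O from Set.inter_subset_left) hO)
      · exact Order.Ideal.principal_le_iff.2
          (J.lower (show (⟨(O : Set X) ∩ P, hmem⟩ : Ω₀) ≤ P from Set.inter_subset_right) hP)
    · rintro I J hIJ ⟨O, hO, hx⟩
      exact ⟨O, hIJ hO, hx⟩
  completelyPrime := by
    rintro A s hs hxs
    change x ∈ idealUnion s at hxs
    change ∃ I ∈ A, x ∈ idealUnion I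
    by_contra hcon
    let J : Order.Ideal Ω₀ :=
      { carrier := {O | x ∉ (O : Set X)}
        lower' := fun O P hPO hO hx => hO (hPO hx)
        nonempty' := ⟨⟨∅, hΩ.empty_mem⟩, fun h => h⟩
        directed' := by
          intro O hO P hP
          exact ⟨⟨(O : Set X) ∪ P, hΩ.union_mem O O.2 P P.2⟩, fun h => h.elim hO hP,
            Set.subset_union_left, Set.subset_union_right⟩ }
    have hJ : J ∈ upperBounds A := fun I hI O hO hx => hcon ⟨I, hI, O, hO, hx⟩
    obtain ⟨O, hO, hx⟩ := hxs
    exact hs.2 hJ hO hx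

/-! ### Step functions -/

open Classical in
/-- The single-step function `b χ_O`. -/
noncomputable def singleStep {Y D : Type*} [PartialOrder D] [OrderBot D] (b : D) (O : Set Y) :
    Y → D :=
  fun y => if y ∈ O then b else ⊥

/-- The consistency condition on a finite family of single-step functions `b i χ_(O i)`. -/
def Consistent {Y D : Type*} [PartialOrder D] {n : ℕ} (b : Fin n → D) (O : Fin n → Set Y) :
    Prop :=
  ∀ J : Set (Fin n), (⋂ j ∈ J, O j).Nonempty → ∃ c : D, ∀ j ∈ J, b j ≤ c

/-- `f` is the join of the consistent finite family `b i χ_(O i)`, where every `O i` is in `S`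
and every `b i` is in `D₀`. The join is taken in the poset of all functions `Y → D`. -/
structure IsStepRep {Y D : Type*} [PartialOrder D] [OrderBot D] (S : Set (Set Y)) (D₀ : Set D)
    {n : ℕ} (b : Fin n → D) (O : Fin n → Set Y) (f : Y → D) : Prop where
  mem_opens : ∀ i, O i ∈ S
  mem_basis : ∀ i, b i ∈ D₀
  consistent : Consistent b O
  isLUB : IsLUB (Set.range fun i => singleStep (b i) (O i)) f

/-- Step functions with opens from `S` and values from `D₀`. -/
def stepFunctions {Y D : Type*} [PartialOrder D] [OrderBot D] (S : Set (Set Y)) (D₀ : Set D) :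
    Set (Y → D) :=
  {f | ∃ (n : ℕ) (b : Fin n → D) (O : Fin n → Set Y), IsStepRep S D₀ b O f}

/-- The set of step functions on `X` with opens from `Ω₀` and values from `D₀`. -/
abbrev BAbs {X D : Type*} [PartialOrder D] [OrderBot D] (Ω₀ : Set (Set X)) (D₀ : Set D) :
    Set (X → D) :=
  stepFunctions Ω₀ D₀

/-- The set of step functions on the spectral compactification, with opens of the form
`𝒪_(↓W)` for `W ∈ Ω₀` and values from `D₀`. -/
def BHat {X D : Type*} [PartialOrder D] [OrderBot D] [TopologicalSpace D]
    (Ω₀ : Set (Set X)) (D₀ : Set D) : Set C(Spect Ω₀, D) :=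
  {f | ⇑f ∈ stepFunctions (Set.range fun W : Ω₀ => hullOpen (Order.Ideal.principal W)) D₀}

/-- The relation `≺` on `BAbs Ω₀ D₀`: for some representation of `f` as the join of the
`b i χ_(O i)`, every `O i` is contained in the preimage under `g` of the set of
elements way above `b i`. -/
def Prec {X D : Type*} [PartialOrder D] [OrderBot D] (Ω₀ : Set (Set X)) (D₀ : Set D)
    (f g : BAbs Ω₀ D₀) : Prop :=
  ∃ (n : ℕ) (b : Fin n → D) (O : Fin n → Set X), IsStepRep Ω₀ D₀ b O f ∧
    ∀ i, O i ⊆ (g : X → D) ⁻¹' {d | WayBelow (b i) d}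

end FunDom

namespace FunDom

/-! ### The way-below relation -/

section WayBelow

variable {α : Type*}

/-! The sets `basicOpen W` form a base of the spectral compactification, are closed under finite
unions and intersections, and are pulled back by `ι` to the sets `W`. Two further facts carry the
proof.

Compactness (`isCompact_basicOpen`, from the prime ideal theorem): if a step function is pointwise
way below `g` and a directed family has join at least `g`, each step already lies below a single
member of the family, so the step function is way below `g`. Conversely, the step functions
pointwise way below `g` are directed with join `g`, so anything way below `g` lies under one of
them. Hence on step functions `≪` is pointwise, and `BHat` is a basis.

Patch density of `ι` (`exists_iota_mem_iff`): a finite family of basic opens cannot distinguish a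
point `y` from a suitable `ι x`. A step function only sees finitely many opens, so equality,
consistency and pointwise `≪` can all be tested on `X`. As `≺` is itself pointwise `≪` on `X`
(`prec_iff`), composition with `ι` matches `(BHat, ≪)` with `(BAbs, ≺)`.

The rest is general: a basis of a dcpo is an abstract basis under `≪`, and its rounded ideal
completion is the dcpo. -/

theorem WayBelow.le [Preorder α] {x y : α} (h : WayBelow x y) : x ≤ y := by
  obtain ⟨d, rfl, hd⟩ := h {y} (Set.singleton_nonempty y)
    (directedOn_singleton y) y isLUB_singleton le_rfl
  exact hd

theorem WayBelow.mono [Preorder α] {x x' y y' : α} (hx : x' ≤ x) (h : WayBelow x y)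
    (hy : y ≤ y') : WayBelow x' y' := fun A hA hdir s hs hle =>
  let ⟨d, hd, hxd⟩ := h A hA hdir s hs (hy.trans hle)
  ⟨d, hd, hx.trans hxd⟩

theorem WayBelow.trans [Preorder α] {x y z : α} (h : WayBelow x y) (h' : WayBelow y z) :
    WayBelow x z := h.mono le_rfl h'.le

/-- A join of finitely many elements way below `x` is way below `x`. -/
theorem WayBelow.of_isLUB_range [Preorder α] {κ : Type*} [Finite κ] {a : κ → α} {x s : α}
    (ha : ∀ i, WayBelow (a i) x) (hs : IsLUB (Set.range a) s) : WayBelow s x := by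
  intro A hA hdir t ht hxt
  choose d hdA had using fun i => ha i A hA hdir t ht hxt
  have : Nonempty A := hA.to_subtype
  obtain ⟨z, hz⟩ := (directedOn_iff_directed.1 hdir).finite_le fun i => (⟨d i, hdA i⟩ : A)
  exact ⟨z, z.2, hs.2 (Set.forall_mem_range.2 fun i => (had i).trans (hz i))⟩

theorem wayBelow_of_isBot [Preorder α] {x y : α} (h : IsBot x) : WayBelow x y :=
  fun _ ⟨d, hd⟩ _ _ _ _ => ⟨d, hd, h d⟩

/-- The interpolation property of a continuous poset. -/
theorem WayBelow.interpolate [Preorder α] {B : Set α} (hB : IsDomBasis B) {a x : α}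
    (h : WayBelow a x) : ∃ b ∈ B, WayBelow a b ∧ WayBelow b x := by
  -- The elements `c ≪ b ≪ x` with `b`, `c` in `B` form a directed set with join `x`; some `c` in it
  -- is then above `a`.
  have hne : {c | ∃ b ∈ {a | WayBelow a x} ∩ B, c ∈ {a | WayBelow a b} ∩ B}.Nonempty := by
    obtain ⟨b, hb⟩ := (hB x).1
    obtain ⟨c, hc⟩ := (hB b).1
    exact ⟨c, b, hb, hc⟩
  have hdir : DirectedOn (· ≤ ·)
      {c | ∃ b ∈ {a | WayBelow a x} ∩ B, c ∈ {a | WayBelow a b} ∩ B} := by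
    rintro c ⟨b, hb, hcb, hc⟩ c' ⟨b', hb', hcb', hc'⟩
    obtain ⟨d, hd, hbd, hbd'⟩ := (hB x).2.1 b hb b' hb'
    obtain ⟨e, he, hce, hce'⟩ := (hB d).2.1 c ⟨hcb.mono le_rfl hbd, hc⟩ c'
      ⟨hcb'.mono le_rfl hbd', hc'⟩
    exact ⟨e, ⟨d, hd, he⟩, hce, hce'⟩
  have hlub : IsLUB {c | ∃ b ∈ {a | WayBelow a x} ∩ B, c ∈ {a | WayBelow a b} ∩ B} x :=
    ⟨fun c ⟨b, hb, hc⟩ => hc.1.le.trans hb.1.le,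
      fun u hu => (hB x).2.2.2 fun b hb => (hB b).2.2.2 fun c hc => hu ⟨b, hb, hc⟩⟩
  obtain ⟨c, ⟨b, ⟨hbx, hb⟩, hcb, -⟩, hac⟩ := h _ hne hdir x hlub le_rfl
  exact ⟨b, hb, hcb.mono hac le_rfl, hbx⟩

/-- The elements way above `b` form a Scott open set. -/
theorem isOpen_wayAbove [Preorder α] [TopologicalSpace α] [Topology.IsScott α Set.univ]
    {B : Set α} (hB : IsDomBasis B) (b : α) : IsOpen {d | WayBelow b d} := by
  rw [Topology.IsScott.isOpen_iff_isUpperSet_and_dirSupInaccOn (D := Set.univ)]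
  refine ⟨fun x y hxy hx => hx.mono le_rfl hxy, dirSupInaccOn_univ.2 ?_⟩
  intro A hA hdir s hs hbs
  obtain ⟨c, -, hbc, hcs⟩ := WayBelow.interpolate hB hbs
  obtain ⟨d, hd, hcd⟩ := hcs A hA hdir s hs le_rfl
  exact ⟨d, hd, hbc.mono le_rfl hcd⟩

end WayBelow

/-! ### The rounded ideal completion of a basis -/

section Completion

variable {α β : Type*} [PartialOrder α] {k : β → α} {r : β → β → Prop}

theorem isAbstractBasis_of_isDomBasis (hB : IsDomBasis (Set.range k))
    (hr : ∀ a b, r a b ↔ WayBelow (k a) (k b)) : IsAbstractBasis r where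
  trans x y z := by
    simp only [hr]
    exact WayBelow.trans
  interpolation A x hA hAx := by
    have : Finite A := hA
    choose c hcB hac hcx using fun a : A =>
      WayBelow.interpolate hB ((hr _ _).1 (hAx a a.2))
    have : Nonempty ↑({a | WayBelow a (k x)} ∩ Set.range k) := (hB (k x)).1.to_subtype
    obtain ⟨z, hz⟩ := (directedOn_iff_directed.1 (hB (k x)).2.1).finite_le fun a : A =>
      (⟨c a, hcx a, hcB a⟩ : ↑({a | WayBelow a (k x)} ∩ Set.range k))
    obtain ⟨z, hzx, y, rfl⟩ := z
    exact ⟨y, fun a ha => (hr _ _).2 ((hac ⟨a, ha⟩).mono le_rfl (hz ⟨a, ha⟩)), (hr _ _).2 hzx⟩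

/-- The rounded ideal of the basis elements way below `x`. -/
def wayBelowIdeal (hB : IsDomBasis (Set.range k))
    (hr : ∀ a b, r a b ↔ WayBelow (k a) (k b)) (x : α) : RoundedIdeal r where
  carrier := {b | WayBelow (k b) x}
  lower a b hab hb := ((hr a b).1 hab).trans hb
  directed A hA hAx := by
    have : Finite A := hA
    choose c hcB hac hcx using fun a : A => WayBelow.interpolate hB (hAx a.2)
    have : Nonempty ↑({a | WayBelow a x} ∩ Set.range k) := (hB x).1.to_subtype
    obtain ⟨z, hz⟩ := (directedOn_iff_directed.1 (hB x).2.1).finite_le fun a : A =>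
      (⟨c a, hcx a, hcB a⟩ : ↑({a | WayBelow a x} ∩ Set.range k))
    obtain ⟨z, hzx, y, rfl⟩ := z
    exact ⟨y, hzx, fun a ha => (hr _ _).2 ((hac ⟨a, ha⟩).mono le_rfl (hz ⟨a, ha⟩))⟩

theorem isLUB_wayBelowIdeal (hB : IsDomBasis (Set.range k))
    (hr : ∀ a b, r a b ↔ WayBelow (k a) (k b)) (x : α) :
    IsLUB (k '' (wayBelowIdeal hB hr x).carrier) x := by
  convert! (hB x).2.2 using 1
  ext a
  constructor
  · rintro ⟨b, hb, rfl⟩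
    exact ⟨hb, b, rfl⟩
  · rintro ⟨ha, b, rfl⟩
    exact ⟨b, ha, rfl⟩

/-- A rounded ideal `I` comes from the join of its image: interpolation puts what is way below that
join into `I`, and roundedness gives the converse. -/
theorem wayBelowIdeal_surjective (hd : IsDcpo α) (hB : IsDomBasis (Set.range k))
    (hr : ∀ a b, r a b ↔ WayBelow (k a) (k b)) : Function.Surjective (wayBelowIdeal hB hr) := by
  intro I
  have hne : (k '' I.carrier).Nonempty := by
    obtain ⟨y, hy, -⟩ := I.directed ∅ Set.finite_empty (Set.empty_subset _)
    exact ⟨_, y, hy, rfl⟩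
  have hdir : DirectedOn (· ≤ ·) (k '' I.carrier) := by
    rintro _ ⟨a, ha, rfl⟩ _ ⟨b, hb, rfl⟩
    obtain ⟨y, hy, hab⟩ := I.directed {a, b} (Set.toFinite _) (Set.pair_subset ha hb)
    exact ⟨_, ⟨y, hy, rfl⟩, ((hr _ _).1 (hab a (by simp))).le, ((hr _ _).1 (hab b (by simp))).le⟩
  obtain ⟨s, hs⟩ := hd _ hne hdir
  refine ⟨s, RoundedIdeal.carrier_injective (Set.ext fun b => ⟨fun hb => ?_, fun hb => ?_⟩)⟩
  · obtain ⟨_, ⟨c, hc, rfl⟩, hbc⟩ := WayBelow.interpolate hB hb |>.elim fun c hc =>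
      hc.2.2 _ hne hdir s hs le_rfl |>.elim fun d hd =>
        (⟨d, hd.1, hc.2.1.mono le_rfl hd.2⟩ : ∃ d ∈ k '' I.carrier, WayBelow (k b) d)
    exact I.lower b c ((hr _ _).2 hbc) hc
  · obtain ⟨y, hy, hby⟩ := I.directed {b} (Set.finite_singleton b) (Set.singleton_subset_iff.2 hb)
    exact ((hr _ _).1 (hby b rfl)).mono le_rfl (hs.1 ⟨y, hy, rfl⟩)

/-- A dcpo is isomorphic to the rounded ideal completion of a basis. -/
theorem exists_roundedIdeal_orderIso (hd : IsDcpo α) (hB : IsDomBasis (Set.range k))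
    (hr : ∀ a b, r a b ↔ WayBelow (k a) (k b)) :
    ∃ e : RoundedIdeal r ≃o α, ∀ I, IsLUB (k '' I.carrier) (e I) := by
  have hle : ∀ x y, wayBelowIdeal hB hr x ≤ wayBelowIdeal hB hr y ↔ x ≤ y := by
    intro x y
    refine ⟨fun h => ?_, fun h b hb => WayBelow.mono le_rfl hb h⟩
    exact (isLUB_wayBelowIdeal hB hr x).mono (isLUB_wayBelowIdeal hB hr y) (Set.image_mono h)
  let φ : α ↪o RoundedIdeal r := OrderEmbedding.ofMapLEIff (wayBelowIdeal hB hr) hle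
  let e : α ≃o RoundedIdeal r := RelIso.ofSurjective φ (wayBelowIdeal_surjective hd hB hr)
  refine ⟨e.symm, fun I => ?_⟩
  obtain ⟨x, rfl⟩ := e.surjective I
  rw [e.symm_apply_apply]
  exact isLUB_wayBelowIdeal hB hr x

end Completion

/-! ### Points and open sets of the spectral compactification -/

section Spectral

variable {X : Type*} {Ω₀ : Set (Set X)}

/-- The open set `𝒪_(↓W)`. -/
abbrev basicOpen (W : Ω₀) : Set (Spect Ω₀) := hullOpen (Order.Ideal.principal W)

theorem mem_basicOpen_iff {W : Ω₀} {y : Spect Ω₀} :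
    y ∈ basicOpen W ↔ Order.Ideal.principal W ∈ y.toPFilter := Iff.rfl

theorem isOpen_hullOpen {L : Type*} [PartialOrder L] (u : L) : IsOpen (hullOpen u) :=
  TopologicalSpace.isOpen_generateFrom_of_mem ⟨u, rfl⟩

theorem basicOpen_mono {V W : Ω₀} (h : V ≤ W) : basicOpen V ⊆ basicOpen W := fun _ hy =>
  Order.PFilter.mem_of_le (Order.Ideal.principal_le_iff.2 h) (mem_basicOpen_iff.1 hy)

/-- An ideal is the join of the principal ideals of its members, so complete primeness of `y`
applies. -/
theorem exists_mem_basicOpen {I : Order.Ideal Ω₀} {y : Spect Ω₀} (hy : y ∈ hullOpen I) :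
    ∃ W ∈ I, y ∈ basicOpen W := by
  have hlub : IsLUB (Order.Ideal.principal '' (I : Set Ω₀)) I := by
    refine ⟨?_, fun J hJ W hW => Order.Ideal.principal_le_iff.1 (hJ ⟨W, hW, rfl⟩)⟩
    rintro _ ⟨W, hW, rfl⟩
    exact Order.Ideal.principal_le_iff.2 hW
  obtain ⟨_, ⟨W, hW, rfl⟩, h⟩ := y.completelyPrime _ I hlub hy
  exact ⟨W, hW, h⟩

variable [TopologicalSpace X]

/-- A viable base is a distributive lattice. -/
abbrev IsViableBase.distribLattice (hΩ : IsViableBase Ω₀) : DistribLattice Ω₀ where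
  __ := (inferInstance : PartialOrder Ω₀)
  sup U V := ⟨U ∪ V, hΩ.union_mem U U.2 V V.2⟩
  inf U V := ⟨U ∩ V, hΩ.inter_mem U U.2 V V.2⟩
  le_sup_left U _ := Set.subset_union_left (s := (U : Set X))
  le_sup_right _ V := Set.subset_union_right (t := (V : Set X))
  sup_le U V W := Set.union_subset (s := (U : Set X)) (t := V) (r := W)
  inf_le_left U _ := Set.inter_subset_left (s := (U : Set X))
  inf_le_right _ V := Set.inter_subset_right (t := (V : Set X))
  le_inf U V W := Set.subset_inter (r := (U : Set X)) (s := V) (t := W)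
  le_sup_inf U V W := (Set.union_inter_distrib_left (U : Set X) V W).ge

theorem iota_mem_basicOpen (hΩ : IsViableBase Ω₀) {x : X} {W : Ω₀} :
    iota hΩ x ∈ basicOpen W ↔ x ∈ (W : Set X) :=
  ⟨fun ⟨_, hO, hx⟩ => hO hx, fun h => ⟨W, Order.Ideal.mem_principal_self, h⟩⟩

theorem basicOpen_inter (hΩ : IsViableBase Ω₀) (U V : Ω₀) :
    basicOpen U ∩ basicOpen V = basicOpen ⟨U ∩ V, hΩ.inter_mem U U.2 V V.2⟩ := by
  refine Set.Subset.antisymm ?_ (Set.subset_inter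
    (basicOpen_mono (Set.inter_subset_left (s := (U : Set X))))
    (basicOpen_mono (Set.inter_subset_right (t := (V : Set X)))))
  rintro y ⟨hU, hV⟩
  obtain ⟨J, hJ, hJU, hJV⟩ := y.toPFilter.directed _ hU _ hV
  obtain ⟨W, hW, hy⟩ := exists_mem_basicOpen hJ
  have hWU : W ≤ U := hJU hW
  have hWV : W ≤ V := hJV hW
  exact basicOpen_mono (Set.subset_inter (r := (W : Set X)) hWU hWV) hy

theorem basicOpen_univ (hΩ : IsViableBase Ω₀) :
    basicOpen (⟨Set.univ, hΩ.univ_mem⟩ : Ω₀) = Set.univ := by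
  refine Set.eq_univ_of_forall fun y => ?_
  obtain ⟨J, hJ⟩ := y.toPFilter.nonempty
  obtain ⟨W, -, hy⟩ := exists_mem_basicOpen hJ
  exact basicOpen_mono (Set.subset_univ (W : Set X)) hy

theorem basicOpen_empty (hΩ : IsViableBase Ω₀) :
    basicOpen (⟨∅, hΩ.empty_mem⟩ : Ω₀) = ∅ := by
  refine Set.eq_empty_of_forall_notMem fun y hy => ?_
  have hbot : IsBot (Order.Ideal.principal (⟨∅, hΩ.empty_mem⟩ : Ω₀)) := fun I =>
    I.nonempty.elim fun W hW =>
      Order.Ideal.principal_le_iff.2 (I.lower (Set.empty_subset (W : Set X)) hW)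
  obtain ⟨_, h, -⟩ := y.completelyPrime ∅ _ (isLUB_empty_iff.2 hbot) hy
  exact h

theorem basicOpen_union (hΩ : IsViableBase Ω₀) (U V : Ω₀) :
    basicOpen (⟨U ∪ V, hΩ.union_mem U U.2 V V.2⟩ : Ω₀) = basicOpen U ∪ basicOpen V := by
  refine Set.Subset.antisymm ?_ (Set.union_subset
    (basicOpen_mono (Set.subset_union_left (s := (U : Set X))))
    (basicOpen_mono (Set.subset_union_right (t := (V : Set X)))))
  intro y hy
  have hlub : IsLUB {Order.Ideal.principal U, Order.Ideal.principal V}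
      (Order.Ideal.principal (⟨U ∪ V, hΩ.union_mem U U.2 V V.2⟩ : Ω₀)) := by
    refine ⟨?_, fun J hJ => ?_⟩
    · rintro _ (rfl | rfl)
      · exact Order.Ideal.principal_le_iff.2 (Set.subset_union_left (s := (U : Set X)))
      · exact Order.Ideal.principal_le_iff.2 (Set.subset_union_right (t := (V : Set X)))
    · obtain ⟨W, hW, hUW, hVW⟩ := J.directed U (Order.Ideal.principal_le_iff.1 (hJ (Or.inl rfl)))
        V (Order.Ideal.principal_le_iff.1 (hJ (Or.inr rfl)))
      exact Order.Ideal.principal_le_iff.2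
        (J.lower (Set.union_subset (s := (U : Set X)) (t := V) hUW hVW) hW)
  obtain ⟨_, rfl | rfl, h⟩ := y.completelyPrime _ _ hlub hy
  · exact Or.inl h
  · exact Or.inr h

/-- The sets `𝒪_(↓W)` form a base of the topology. -/
theorem isTopologicalBasis_basicOpen (hΩ : IsViableBase Ω₀) :
    TopologicalSpace.IsTopologicalBasis (Set.range (basicOpen : Ω₀ → Set (Spect Ω₀))) where
  exists_subset_inter := by
    rintro _ ⟨U, rfl⟩ _ ⟨V, rfl⟩ y hy
    exact ⟨_, ⟨_, rfl⟩, (basicOpen_inter hΩ U V).le hy, (basicOpen_inter hΩ U V).ge⟩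
  sUnion_eq := Set.eq_univ_of_forall fun _ =>
    ⟨_, ⟨_, rfl⟩, (basicOpen_univ hΩ).ge (Set.mem_univ _)⟩
  eq_generateFrom := by
    refine le_antisymm (le_generateFrom ?_) (le_generateFrom ?_)
    · rintro _ ⟨W, rfl⟩
      exact isOpen_hullOpen _
    · rintro _ ⟨I, rfl⟩
      have : hullOpen I = ⋃ W ∈ I, basicOpen W := by
        ext y
        simp only [Set.mem_iUnion, exists_prop]
        refine ⟨exists_mem_basicOpen, fun ⟨W, hW, hy⟩ => ?_⟩
        exact Order.PFilter.mem_of_le (Order.Ideal.principal_le_iff.2 hW) (mem_basicOpen_iff.1 hy)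
      rw [this]
      -- Openness is meant here in the topology generated by the basic opens, so that one is made
      -- the local instance.
      let := TopologicalSpace.generateFrom (Set.range (basicOpen : Ω₀ → Set (Spect Ω₀)))
      exact isOpen_biUnion fun W _ => TopologicalSpace.isOpen_generateFrom_of_mem ⟨W, rfl⟩

/-- A point of the spectral compactification outside all `𝒪_(↓W)` with `W ∈ J` and inside all
others, for `J` a prime ideal. -/
theorem exists_point_of_prime (hΩ : IsViableBase Ω₀) (J : Order.Ideal Ω₀)
    (huniv : (⟨Set.univ, hΩ.univ_mem⟩ : Ω₀) ∉ J)
    (hprime : ∀ U V : Ω₀, (⟨U ∩ V, hΩ.inter_mem U U.2 V V.2⟩ : Ω₀) ∈ J → U ∈ J ∨ V ∈ J) :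
    ∃ y : Spect Ω₀, ∀ W, y ∈ basicOpen W ↔ W ∉ J := by
  -- Primeness of `J` is what makes this set filtered; complete primeness is automatic, since a join
  -- lies below `J` once all its members do.
  have hF : Order.IsPFilter {I : Order.Ideal Ω₀ | ¬ I ≤ J} := by
    refine Order.IsPFilter.of_def ⟨Order.Ideal.principal _, mt Order.Ideal.principal_le_iff.1 huniv⟩
      ?_ fun hIK hI hK => hI (hIK.trans hK)
    intro I hI K hK
    obtain ⟨U, hU, hUJ⟩ := Set.not_subset.1 hI
    obtain ⟨V, hV, hVJ⟩ := Set.not_subset.1 hK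
    refine ⟨Order.Ideal.principal ⟨U ∩ V, hΩ.inter_mem U U.2 V V.2⟩, fun h => ?_, ?_, ?_⟩
    · exact (hprime U V (Order.Ideal.principal_le_iff.1 h)).elim hUJ hVJ
    · exact Order.Ideal.principal_le_iff.2
        (I.lower (Set.inter_subset_left (s := (U : Set X))) hU)
    · exact Order.Ideal.principal_le_iff.2
        (K.lower (Set.inter_subset_right (t := (V : Set X))) hV)
  refine ⟨⟨hF.toPFilter, fun A s hs hsJ => ?_⟩, fun W => not_congr Order.Ideal.principal_le_iff⟩
  change ¬ s ≤ J at hsJ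
  change ∃ I ∈ A, ¬ I ≤ J
  by_contra! h
  exact hsJ (hs.2 h)

/-- The `V` whose basic open is finitely covered form an ideal `J`. If `W ∉ J`, a prime ideal `P ⊇
J` avoiding `W` gives a point of `basicOpen W`; a basic neighbourhood `basicOpen V` of it inside one
cover member has `V ∈ J ⊆ P`, a contradiction. -/
theorem isCompact_basicOpen (hΩ : IsViableBase Ω₀) (W : Ω₀) : IsCompact (basicOpen W) := by
  refine isCompact_of_finite_subcover fun {κ} U hU hWU => ?_
  let J : Order.Ideal Ω₀ :=
    { carrier := {V | ∃ t : Finset κ, basicOpen V ⊆ ⋃ i ∈ t, U i}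
      lower' := fun V V' hV ⟨t, ht⟩ => ⟨t, (basicOpen_mono hV).trans ht⟩
      nonempty' := ⟨⟨∅, hΩ.empty_mem⟩, ∅, by rw [basicOpen_empty hΩ]; exact Set.empty_subset _⟩
      directed' := by
        classical
        rintro V ⟨t, ht⟩ V' ⟨t', ht'⟩
        refine ⟨⟨V ∪ V', hΩ.union_mem V V.2 V' V'.2⟩, ⟨t ∪ t', ?_⟩,
          Set.subset_union_left (s := (V : Set X)), Set.subset_union_right (t := (V' : Set X))⟩
        rw [basicOpen_union hΩ, Finset.set_biUnion_union]
        exact Set.union_subset_union ht ht' }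
  by_contra hW
  have hdisj : Disjoint (Order.PFilter.principal W : Set Ω₀) (J : Set Ω₀) :=
    Set.disjoint_left.2 fun V hWV hV => hW (J.lower hWV hV)
  let := hΩ.distribLattice
  obtain ⟨P, hP, hJP, hWP⟩ := DistribLattice.prime_ideal_of_disjoint_filter_ideal hdisj
  have hWP' : W ∉ P := Set.disjoint_left.1 hWP (le_refl W)
  obtain ⟨y, hy⟩ := exists_point_of_prime hΩ P
    (fun h => hWP' (P.lower (Set.subset_univ (W : Set X)) h)) fun U V => hP.mem_or_mem
  obtain ⟨i, hi⟩ := Set.mem_iUnion.1 (hWU ((hy W).2 hWP'))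
  obtain ⟨_, ⟨V, rfl⟩, hyV, hVU⟩ :=
    (isTopologicalBasis_basicOpen hΩ).exists_subset_of_mem_open hi (hU i)
  refine (hy V).1 hyV (hJP ⟨{i}, ?_⟩)
  simpa using hVU

theorem biInter_basicOpen (hΩ : IsViableBase Ω₀) {κ : Type*} (W : κ → Ω₀) (s : Finset κ) :
    ∃ V : Ω₀, (V : Set X) = ⋂ i ∈ s, (W i : Set X) ∧ basicOpen V = ⋂ i ∈ s, basicOpen (W i) := by
  classical
  induction s using Finset.induction_on with
  | empty => exact ⟨⟨_, hΩ.univ_mem⟩, by simp, by simp [basicOpen_univ hΩ]⟩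
  | insert i s _ ih =>
    obtain ⟨V, hV, hV'⟩ := ih
    refine ⟨⟨W i ∩ V, hΩ.inter_mem _ (W i).2 V V.2⟩, ?_, ?_⟩
    · rw [Finset.set_biInter_insert, ← hV]
    · rw [Finset.set_biInter_insert, ← hV', basicOpen_inter hΩ]

theorem biUnion_basicOpen (hΩ : IsViableBase Ω₀) {κ : Type*} (W : κ → Ω₀) (s : Finset κ) :
    ∃ V : Ω₀, (V : Set X) = ⋃ i ∈ s, (W i : Set X) ∧ basicOpen V = ⋃ i ∈ s, basicOpen (W i) := by
  classical
  induction s using Finset.induction_on with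
  | empty => exact ⟨⟨_, hΩ.empty_mem⟩, by simp, by simp [basicOpen_empty hΩ]⟩
  | insert i s _ ih =>
    obtain ⟨V, hV, hV'⟩ := ih
    refine ⟨⟨W i ∪ V, hΩ.union_mem _ (W i).2 V V.2⟩, ?_, ?_⟩
    · rw [Finset.set_biUnion_insert, ← hV]
    · rw [Finset.set_biUnion_insert, ← hV', basicOpen_union hΩ]

/-- The image of `ι` is dense in the patch topology. -/
theorem exists_iota_mem_iff (hΩ : IsViableBase Ω₀) {κ : Type*} [Finite κ] (W : κ → Ω₀)
    (y : Spect Ω₀) : ∃ x, ∀ i, iota hΩ x ∈ basicOpen (W i) ↔ y ∈ basicOpen (W i) := by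
  classical
  have := Fintype.ofFinite κ
  obtain ⟨U, hU, hU'⟩ := biInter_basicOpen hΩ W (Finset.univ.filter fun i => y ∈ basicOpen (W i))
  obtain ⟨V, hV, hV'⟩ := biUnion_basicOpen hΩ W (Finset.univ.filter fun i => y ∉ basicOpen (W i))
  have hyU : y ∈ basicOpen U := by
    rw [hU']
    simp
  have hyV : y ∉ basicOpen V := by
    rw [hV']
    simp
  -- `U` intersects the `W i` whose basic open contains `y`, and `V` unites the others; a point of
  -- `U \ V` has the same membership pattern as `y`.
  obtain ⟨x, hxU, hxV⟩ := Set.not_subset.1 fun h : (U : Set X) ⊆ V => hyV (basicOpen_mono h hyU)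
  rw [hU] at hxU
  rw [hV] at hxV
  simp only [Finset.mem_filter, Finset.mem_univ, true_and, Set.mem_iInter] at hxU
  simp only [Finset.mem_filter, Finset.mem_univ, true_and, Set.mem_iUnion, exists_prop,
    not_exists, not_and] at hxV
  refine ⟨x, fun i => ?_⟩
  rw [iota_mem_basicOpen]
  exact ⟨fun hx => not_not.1 fun hy => hxV i hy hx, hxU i⟩

end Spectral

/-! ### Joins of single-step functions -/

section StepFunctions

/-- At a point `y` the critical `J` consists of all indices whose open contains `y`. -/
theorem consistent_iff {Y D : Type*} [PartialOrder D] {n : ℕ} {b : Fin n → D} {O : Fin n → Set Y} :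
    Consistent b O ↔ ∀ y, ∃ c, ∀ i, y ∈ O i → b i ≤ c := by
  refine ⟨fun h y => h {i | y ∈ O i} ⟨y, Set.mem_iInter₂.2 fun i hi => hi⟩, ?_⟩
  rintro h J ⟨y, hy⟩
  obtain ⟨c, hc⟩ := h y
  exact ⟨c, fun j hj => hc j (Set.mem_iInter₂.1 hy j hj)⟩

variable {Y D κ : Type*} [PartialOrder D] [OrderBot D] {b : κ → D} {O : κ → Set Y} {f : Y → D}

theorem singleStep_of_mem {c : D} {U : Set Y} {y : Y} (h : y ∈ U) : singleStep c U y = c :=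
  if_pos h

theorem singleStep_of_notMem {c : D} {U : Set Y} {y : Y} (h : y ∉ U) : singleStep c U y = ⊥ :=
  if_neg h

theorem singleStep_le_iff {c d : D} {U : Set Y} {y : Y} :
    singleStep c U y ≤ d ↔ (y ∈ U → c ≤ d) := by
  by_cases h : y ∈ U
  · simp [singleStep_of_mem h, h]
  · simp [singleStep_of_notMem h, h]

theorem isLUB_steps_iff :
    IsLUB (Set.range fun i => singleStep (b i) (O i)) f ↔
      ∀ y, IsLUB (Set.range fun i => singleStep (b i) (O i) y) (f y) := by
  rw [isLUB_pi]
  refine forall_congr' fun y => ?_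
  rw [← Set.range_comp]
  rfl

theorem le_of_isLUB_steps (hf : IsLUB (Set.range fun i => singleStep (b i) (O i)) f) {i : κ}
    {y : Y} (hy : y ∈ O i) : b i ≤ f y := by
  have := (isLUB_steps_iff.1 hf y).1 ⟨i, rfl⟩
  exact singleStep_le_iff.1 this hy

theorem isLUB_steps_le (hf : IsLUB (Set.range fun i => singleStep (b i) (O i)) f) {y : Y} {d : D}
    (h : ∀ i, y ∈ O i → b i ≤ d) : f y ≤ d :=
  (isLUB_steps_iff.1 hf y).2 (Set.forall_mem_range.2 fun i => singleStep_le_iff.2 (h i))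

theorem isLUB_steps_apply_le {Y' : Type*} {O' : κ → Set Y'} {f' : Y' → D}
    (hf : IsLUB (Set.range fun i => singleStep (b i) (O i)) f)
    (hf' : IsLUB (Set.range fun i => singleStep (b i) (O' i)) f') {y : Y} {y' : Y'}
    (h : ∀ i, y ∈ O i → y' ∈ O' i) : f y ≤ f' y' :=
  isLUB_steps_le hf fun i hi => le_of_isLUB_steps hf' (h i hi)

theorem isLUB_steps_apply_eq {Y' : Type*} {O' : κ → Set Y'} {f' : Y' → D}
    (hf : IsLUB (Set.range fun i => singleStep (b i) (O i)) f)
    (hf' : IsLUB (Set.range fun i => singleStep (b i) (O' i)) f') {y : Y} {y' : Y'}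
    (h : ∀ i, y ∈ O i ↔ y' ∈ O' i) : f y = f' y' :=
  (isLUB_steps_apply_le hf hf' fun i => (h i).1).antisymm
    (isLUB_steps_apply_le hf' hf fun i => (h i).2)

/-- Way-belowness of the values of a step function can be checked on the steps. -/
theorem isLUB_steps_wayBelow_iff [Finite κ]
    (hf : IsLUB (Set.range fun i => singleStep (b i) (O i)) f) {g : Y → D} :
    (∀ y, WayBelow (f y) (g y)) ↔ ∀ i, O i ⊆ g ⁻¹' {d | WayBelow (b i) d} := by
  refine ⟨fun h i y hy => (h y).mono (le_of_isLUB_steps hf hy) le_rfl, fun h y => ?_⟩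
  refine WayBelow.of_isLUB_range (fun i => ?_) (isLUB_steps_iff.1 hf y)
  by_cases hy : y ∈ O i
  · rw [singleStep_of_mem hy]
    exact h i hy
  · rw [singleStep_of_notMem hy]
    exact wayBelow_of_isBot isBot_bot

/-- Families bounded by a function have joins in a bounded complete poset. -/
theorem exists_isLUB_steps (hD : ∀ A : Set D, BddAbove A → ∃ s, IsLUB A s)
    (h : ∀ y, ∃ c, ∀ i, y ∈ O i → b i ≤ c) :
    ∃ f : Y → D, IsLUB (Set.range fun i => singleStep (b i) (O i)) f := by
  have (y : Y) : ∃ s, IsLUB (Set.range fun i => singleStep (b i) (O i) y) s := by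
    obtain ⟨c, hc⟩ := h y
    exact hD _ ⟨c, Set.forall_mem_range.2 fun i => singleStep_le_iff.2 (hc i)⟩
  choose f hf using this
  exact ⟨f, isLUB_steps_iff.2 hf⟩

/-- Reindexing along an enumeration frees later constructions to use index types such as `Empty`,
`Unit` and sums. -/
theorem mem_stepFunctions_of_finite [Finite κ] {S : Set (Set Y)} {D₀ : Set D}
    (hO : ∀ i, O i ∈ S) (hb : ∀ i, b i ∈ D₀)
    (hf : IsLUB (Set.range fun i => singleStep (b i) (O i)) f) : f ∈ stepFunctions S D₀ := by
  let e := (Finite.equivFin κ).symm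
  refine ⟨Nat.card κ, b ∘ e, O ∘ e, fun i => hO _, fun i => hb _, ?_, ?_⟩
  · exact consistent_iff.2 fun y => ⟨f y, fun i hi => le_of_isLUB_steps hf hi⟩
  · convert! hf using 1
    exact e.surjective.range_comp fun i => singleStep (b i) (O i)

theorem continuous_of_isLUB_steps [Finite κ] [TopologicalSpace Y] [TopologicalSpace D]
    [Topology.IsScott D Set.univ] (hO : ∀ i, IsOpen (O i))
    (hf : IsLUB (Set.range fun i => singleStep (b i) (O i)) f) : Continuous f := by
  refine continuous_def.2 fun U hU => isOpen_iff_mem_nhds.2 fun y hy => ?_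
  -- On this neighbourhood every step active at `y` stays active, so `f` takes values at least `f
  -- y`, and Scott open sets are upper sets.
  have hmem : ⋂ i ∈ {i | y ∈ O i}, O i ∈ nhds y :=
    (Filter.biInter_mem (Set.toFinite _)).2 fun i hi => (hO i).mem_nhds hi
  filter_upwards [hmem] with z hz
  refine Topology.IsScott.isUpperSet_of_isOpen (D := Set.univ) hU ?_ hy
  exact isLUB_steps_apply_le hf hf fun i hi => Set.mem_iInter₂.1 hz i hi

theorem prec_iff {X : Type*} {Ω₀ : Set (Set X)} {D₀ : Set D} {f g : BAbs Ω₀ D₀} :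
    Prec Ω₀ D₀ f g ↔ ∀ x, WayBelow ((f : X → D) x) ((g : X → D) x) := by
  constructor
  · rintro ⟨n, b, O, hf, h⟩
    exact (isLUB_steps_wayBelow_iff hf.isLUB).2 h
  · intro h
    obtain ⟨n, b, O, hf⟩ := f.2
    exact ⟨n, b, O, hf, (isLUB_steps_wayBelow_iff hf.isLUB).1 h⟩

end StepFunctions

/-! ### Directed joins of continuous functions -/

section ContinuousMap

variable {Y D : Type*} [TopologicalSpace Y] [PartialOrder D] [TopologicalSpace D]

theorem directedOn_eval {A : Set C(Y, D)} (hdir : DirectedOn (· ≤ ·) A) (y : Y) :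
    DirectedOn (· ≤ ·) ((fun f : C(Y, D) => f y) '' A) := by
  rintro _ ⟨f, hf, rfl⟩ _ ⟨g, hg, rfl⟩
  obtain ⟨h, hh, hfh, hgh⟩ := hdir f hf g hg
  exact ⟨_, ⟨h, hh, rfl⟩, hfh y, hgh y⟩

theorem isLUB_of_forall_isLUB_eval {A : Set C(Y, D)} {s : C(Y, D)}
    (h : ∀ y, IsLUB ((fun f : C(Y, D) => f y) '' A) (s y)) : IsLUB A s :=
  ⟨fun f hf y => (h y).1 ⟨f, hf, rfl⟩, fun u hu y => (h y).2 <| by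
    rintro _ ⟨f, hf, rfl⟩
    exact hu hf y⟩

variable [Topology.IsScott D Set.univ]

/-- The pointwise join is continuous: Scott open sets are inaccessible by directed joins, so its
preimage of one is the union of the preimages under members of `A`. -/
theorem exists_isLUB_eval (hD : IsDcpo D) {A : Set C(Y, D)} (hne : A.Nonempty)
    (hdir : DirectedOn (· ≤ ·) A) :
    ∃ s : C(Y, D), ∀ y, IsLUB ((fun f : C(Y, D) => f y) '' A) (s y) := by
  choose s hs using fun y => hD _ (hne.image fun f : C(Y, D) => f y) (directedOn_eval hdir y)
  refine ⟨⟨s, continuous_def.2 fun U hU => ?_⟩, hs⟩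
  obtain ⟨hup, hacc⟩ :=
    Topology.IsScott.isOpen_iff_isUpperSet_and_dirSupInaccOn (D := Set.univ) |>.1 hU
  have : s ⁻¹' U = ⋃ f ∈ A, f ⁻¹' U := by
    ext y
    simp only [Set.mem_preimage, Set.mem_iUnion, exists_prop]
    constructor
    · intro hy
      obtain ⟨_, ⟨f, hf, rfl⟩, hfU⟩ := dirSupInaccOn_univ.1 hacc
        (hne.image fun f : C(Y, D) => f y) (directedOn_eval hdir y) (hs y) hy
      exact ⟨f, hf, hfU⟩
    · rintro ⟨f, hf, hfU⟩
      exact hup ((hs y).1 ⟨f, hf, rfl⟩) hfU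
  rw [this]
  exact isOpen_biUnion fun f _ => hU.preimage f.continuous

theorem isDcpo_continuousMap (hD : IsDcpo D) : IsDcpo C(Y, D) := fun _ hne hdir =>
  let ⟨s, hs⟩ := exists_isLUB_eval hD hne hdir
  ⟨s, isLUB_of_forall_isLUB_eval hs⟩

/-- Directed joins of continuous functions are pointwise. -/
theorem isLUB_eval (hD : IsDcpo D) {A : Set C(Y, D)} (hne : A.Nonempty)
    (hdir : DirectedOn (· ≤ ·) A) {s : C(Y, D)} (hs : IsLUB A s) (y : Y) :
    IsLUB ((fun f : C(Y, D) => f y) '' A) (s y) := by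
  obtain ⟨t, ht⟩ := exists_isLUB_eval hD hne hdir
  rw [hs.unique (isLUB_of_forall_isLUB_eval ht)]
  exact ht y

end ContinuousMap

/-! ### Step functions on the spectral compactification -/

section Main

variable {X : Type*} {Ω₀ : Set (Set X)}
  {D : Type*} [PartialOrder D] [OrderBot D] [TopologicalSpace D] {D₀ : Set D}

theorem exists_rep_of_mem_BHat {f : C(Spect Ω₀, D)} (hf : f ∈ BHat Ω₀ D₀) :
    ∃ (n : ℕ) (b : Fin n → D) (W : Fin n → Ω₀), (∀ i, b i ∈ D₀) ∧
      IsLUB (Set.range fun i => singleStep (b i) (basicOpen (W i))) ⇑f := by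
  obtain ⟨n, b, O, h⟩ := hf
  choose W hW using h.mem_opens
  obtain rfl : (fun i => basicOpen (W i)) = O := funext hW
  exact ⟨n, b, W, h.mem_basis, h.isLUB⟩

theorem exists_isLUB_steps_mem_BHat [Topology.IsScott D Set.univ] (hD : IsBCDomain D) {κ : Type*}
    [Finite κ] {b : κ → D} {W : κ → Ω₀} (hb : ∀ i, b i ∈ D₀)
    (h : ∀ y, ∃ c, ∀ i, y ∈ basicOpen (W i) → b i ≤ c) :
    ∃ f ∈ BHat Ω₀ D₀, IsLUB (Set.range fun i => singleStep (b i) (basicOpen (W i))) ⇑f := by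
  obtain ⟨f, hf⟩ := exists_isLUB_steps hD.boundedComplete h
  exact ⟨⟨f, continuous_of_isLUB_steps (fun i => isOpen_hullOpen _) hf⟩,
    mem_stepFunctions_of_finite (fun i => ⟨W i, rfl⟩) hb hf, hf⟩

theorem exists_mem_BHat_forall_wayBelow [Topology.IsScott D Set.univ] (hD : IsBCDomain D)
    (g : C(Spect Ω₀, D)) {κ : Type*} [Finite κ] {b : κ → D} {W : κ → Ω₀}
    (hb : ∀ i, b i ∈ D₀)
    (h : ∀ i, basicOpen (W i) ⊆ g ⁻¹' {d | WayBelow (b i) d}) :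
    ∃ f ∈ {f | f ∈ BHat Ω₀ D₀ ∧ ∀ y, WayBelow (f y) (g y)},
      IsLUB (Set.range fun i => singleStep (b i) (basicOpen (W i))) ⇑f := by
  obtain ⟨f, hf, hfl⟩ := exists_isLUB_steps_mem_BHat hD hb fun y =>
    ⟨g y, fun i hi => (h i hi).le⟩
  exact ⟨f, ⟨hf, (isLUB_steps_wayBelow_iff hfl).2 h⟩, hfl⟩

theorem nonempty_forall_wayBelow [Topology.IsScott D Set.univ] (hD : IsBCDomain D)
    (g : C(Spect Ω₀, D)) :
    {f | f ∈ BHat Ω₀ D₀ ∧ ∀ y, WayBelow (f y) (g y)}.Nonempty :=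
  let ⟨f, hf, _⟩ := exists_mem_BHat_forall_wayBelow hD g (κ := Empty) (b := Empty.elim)
    (W := Empty.elim) Empty.rec Empty.rec
  ⟨f, hf⟩

theorem directedOn_forall_wayBelow [Topology.IsScott D Set.univ] (hD : IsBCDomain D)
    (g : C(Spect Ω₀, D)) :
    DirectedOn (· ≤ ·) {f | f ∈ BHat Ω₀ D₀ ∧ ∀ y, WayBelow (f y) (g y)} := by
  rintro f ⟨hf, hfg⟩ f' ⟨hf', hfg'⟩
  obtain ⟨n, b, W, hb, hf⟩ := exists_rep_of_mem_BHat hf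
  obtain ⟨m, c, V, hc, hf'⟩ := exists_rep_of_mem_BHat hf'
  -- The two families are joined into one; it is consistent because `g` bounds all its steps.
  obtain ⟨k, hk, hkl⟩ := exists_mem_BHat_forall_wayBelow hD g (b := Sum.elim b c)
    (W := Sum.elim W V) (Sum.forall.2 ⟨hb, hc⟩) (Sum.forall.2
      ⟨(isLUB_steps_wayBelow_iff hf).1 hfg, (isLUB_steps_wayBelow_iff hf').1 hfg'⟩)
  exact ⟨k, hk, fun y => isLUB_steps_le hf fun i hi => le_of_isLUB_steps hkl (i := Sum.inl i) hi,
    fun y => isLUB_steps_le hf' fun i hi => le_of_isLUB_steps hkl (i := Sum.inr i) hi⟩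

variable [TopologicalSpace X]

omit [TopologicalSpace D] in
theorem isLUB_steps_comp_iota (hΩ : IsViableBase Ω₀) {κ : Type*} {b : κ → D} {W : κ → Ω₀}
    {f : Spect Ω₀ → D} (hf : IsLUB (Set.range fun i => singleStep (b i) (basicOpen (W i))) f) :
    IsLUB (Set.range fun i => singleStep (b i) (W i : Set X)) (f ∘ iota hΩ) := by
  refine isLUB_steps_iff.2 fun x => ?_
  have h (i : κ) : singleStep (b i) (W i : Set X) x =
      singleStep (b i) (basicOpen (W i)) (iota hΩ x) := by
    classical
    exact if_congr (iota_mem_basicOpen hΩ).symm rfl rfl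
  simp_rw [h]
  exact isLUB_steps_iff.1 hf (iota hΩ x)

theorem comp_iota_mem_BAbs (hΩ : IsViableBase Ω₀) {f : C(Spect Ω₀, D)} (hf : f ∈ BHat Ω₀ D₀) :
    ⇑f ∘ iota hΩ ∈ BAbs Ω₀ D₀ := by
  obtain ⟨n, b, W, hb, hW⟩ := exists_rep_of_mem_BHat hf
  exact mem_stepFunctions_of_finite (fun i => (W i).2) hb (isLUB_steps_comp_iota hΩ hW)

/-- Any pair of values of step functions is attained on the image of `ι`. -/
theorem exists_iota_apply_eq (hΩ : IsViableBase Ω₀) {f g : C(Spect Ω₀, D)} (hf : f ∈ BHat Ω₀ D₀)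
    (hg : g ∈ BHat Ω₀ D₀) (y : Spect Ω₀) : ∃ x, f (iota hΩ x) = f y ∧ g (iota hΩ x) = g y := by
  obtain ⟨n, b, W, -, hf⟩ := exists_rep_of_mem_BHat hf
  obtain ⟨m, c, V, -, hg⟩ := exists_rep_of_mem_BHat hg
  obtain ⟨x, hx⟩ := exists_iota_mem_iff hΩ (Sum.elim W V) y
  exact ⟨x, isLUB_steps_apply_eq hf hf fun i => hx (Sum.inl i),
    isLUB_steps_apply_eq hg hg fun i => hx (Sum.inr i)⟩

theorem injOn_comp_iota (hΩ : IsViableBase Ω₀) :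
    Set.InjOn (fun f : C(Spect Ω₀, D) => ⇑f ∘ iota hΩ) (BHat Ω₀ D₀) := by
  refine fun f hf g hg hfg => ContinuousMap.ext fun y => ?_
  obtain ⟨x, hfx, hgx⟩ := exists_iota_apply_eq hΩ hf hg y
  rw [← hfx, ← hgx]
  exact congrFun hfg x

variable [Topology.IsScott D Set.univ]

theorem bijOn_comp_iota (hD : IsBCDomain D) (hΩ : IsViableBase Ω₀) :
    Set.BijOn (fun f : C(Spect Ω₀, D) => ⇑f ∘ iota hΩ) (BHat Ω₀ D₀) (BAbs Ω₀ D₀) := by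
  refine ⟨fun f hf => comp_iota_mem_BAbs hΩ hf, injOn_comp_iota hΩ, ?_⟩
  rintro f ⟨n, b, O, hf⟩
  lift O to Fin n → Ω₀ using hf.mem_opens
  -- Consistency on `X` transfers to `y` through a point `x` with the same membership pattern.
  obtain ⟨g, hg, hgl⟩ := exists_isLUB_steps_mem_BHat hD hf.mem_basis (W := O) fun y => by
    obtain ⟨x, hx⟩ := exists_iota_mem_iff hΩ O y
    obtain ⟨c, hc⟩ := consistent_iff.1 hf.consistent x
    exact ⟨c, fun i hi => hc i ((iota_mem_basicOpen hΩ).1 ((hx i).2 hi))⟩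
  exact ⟨g, hg, (isLUB_steps_comp_iota hΩ hgl).unique hf.isLUB⟩

/-- A step function that is pointwise way below `g` is way below `g`. -/
theorem wayBelow_of_forall_wayBelow (hD : IsBCDomain D) (hΩ : IsViableBase Ω₀)
    {f g : C(Spect Ω₀, D)} (hf : f ∈ BHat Ω₀ D₀) (h : ∀ y, WayBelow (f y) (g y)) :
    WayBelow f g := by
  obtain ⟨n, b, W, hb, hf⟩ := exists_rep_of_mem_BHat hf
  obtain ⟨B, hB⟩ := hD.continuous
  intro A hne hdir s hs hgs
  have : Nonempty A := hne.to_subtype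
  -- The open sets `{y | b i ≪ d y}`, for `d ∈ A`, form a directed cover of the compact `basicOpen
  -- (W i)`, so one of them suffices.
  have hstep (i : Fin n) : ∃ d : A, basicOpen (W i) ⊆ {y | b i ≤ (d : C(Spect Ω₀, D)) y} := by
    have hcover : basicOpen (W i) ⊆ ⋃ d : A, d.1 ⁻¹' {c | WayBelow (b i) c} := by
      intro y hy
      have hby : WayBelow (b i) (s y) := (h y).mono (le_of_isLUB_steps hf hy) (hgs y)
      obtain ⟨c, -, hbc, hcs⟩ := WayBelow.interpolate hB hby
      obtain ⟨_, ⟨d, hd, rfl⟩, hcd⟩ := hcs _ (hne.image fun f : C(Spect Ω₀, D) => f y)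
        (directedOn_eval hdir y) _ (isLUB_eval hD.dcpo hne hdir hs y) le_rfl
      exact Set.mem_iUnion.2 ⟨⟨d, hd⟩, hbc.mono le_rfl hcd⟩
    obtain ⟨d, hd⟩ := (isCompact_basicOpen hΩ (W i)).elim_directed_cover _
      (fun d => (isOpen_wayAbove hB _).preimage d.1.continuous) hcover
      fun p q => (directedOn_iff_directed.1 hdir p q).imp fun r hr =>
        ⟨fun y hy => WayBelow.mono le_rfl hy (hr.1 y),
          fun y hy => WayBelow.mono le_rfl hy (hr.2 y)⟩
    exact ⟨d, fun y hy => (hd hy).le⟩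
  choose d hd using hstep
  obtain ⟨z, hz⟩ := (directedOn_iff_directed.1 hdir).finite_le d
  exact ⟨z, z.2, fun y => isLUB_steps_le hf fun i hi => (hd i hi).trans (hz i y)⟩

/-- Single steps suffice: for `b ≪ g y`, continuity gives a basic neighbourhood of `y` on which `b`
stays way below `g`. -/
theorem isLUB_forall_wayBelow (hD : IsBCDomain D) (hD₀ : IsDomBasis D₀) (hΩ : IsViableBase Ω₀)
    (g : C(Spect Ω₀, D)) :
    IsLUB {f | f ∈ BHat Ω₀ D₀ ∧ ∀ y, WayBelow (f y) (g y)} g := by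
  refine ⟨fun f hf y => (hf.2 y).le, fun u hu y => (hD₀ (g y)).2.2.2 ?_⟩
  rintro b ⟨hb, hbD⟩
  obtain ⟨_, ⟨W, rfl⟩, hyW, hW⟩ := (isTopologicalBasis_basicOpen hΩ).exists_subset_of_mem_open
    (show y ∈ g ⁻¹' {d | WayBelow b d} from hb) ((isOpen_wayAbove hD₀ b).preimage g.continuous)
  obtain ⟨f, hf, hfl⟩ := exists_mem_BHat_forall_wayBelow hD g (κ := Unit) (b := fun _ => b)
    (W := fun _ => W) (fun _ => hbD) (fun _ => hW)
  exact (le_of_isLUB_steps hfl (i := ()) hyW).trans (hu hf y)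

/-- The way-below relation between step functions and continuous functions is pointwise. -/
theorem wayBelow_iff_of_mem_BHat (hD : IsBCDomain D) (hD₀ : IsDomBasis D₀) (hΩ : IsViableBase Ω₀)
    {f g : C(Spect Ω₀, D)} (hf : f ∈ BHat Ω₀ D₀) :
    WayBelow f g ↔ ∀ y, WayBelow (f y) (g y) := by
  refine ⟨fun h y => ?_, wayBelow_of_forall_wayBelow hD hΩ hf⟩
  obtain ⟨k, hk, hfk⟩ := h _ (nonempty_forall_wayBelow (D₀ := D₀) hD g)
    (directedOn_forall_wayBelow hD g) g (isLUB_forall_wayBelow hD hD₀ hΩ g) le_rfl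
  exact (hk.2 y).mono (hfk y) le_rfl

theorem isDomBasis_BHat (hD : IsBCDomain D) (hD₀ : IsDomBasis D₀) (hΩ : IsViableBase Ω₀) :
    IsDomBasis (BHat Ω₀ D₀) := by
  intro g
  have : {a | WayBelow a g} ∩ BHat Ω₀ D₀ =
      {f | f ∈ BHat Ω₀ D₀ ∧ ∀ y, WayBelow (f y) (g y)} := by
    ext f
    exact ⟨fun h => ⟨h.2, (wayBelow_iff_of_mem_BHat hD hD₀ hΩ h.2).1 h.1⟩,
      fun h => ⟨(wayBelow_iff_of_mem_BHat hD hD₀ hΩ h.1).2 h.2, h.1⟩⟩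
  rw [this]
  exact ⟨nonempty_forall_wayBelow hD g, directedOn_forall_wayBelow hD g,
    isLUB_forall_wayBelow hD hD₀ hΩ g⟩

theorem wayBelow_iff_prec (hD : IsBCDomain D) (hD₀ : IsDomBasis D₀) (hΩ : IsViableBase Ω₀)
    {f g : C(Spect Ω₀, D)} (hf : f ∈ BHat Ω₀ D₀) (hg : g ∈ BHat Ω₀ D₀) {f' g' : BAbs Ω₀ D₀}
    (hf' : (f' : X → D) = ⇑f ∘ iota hΩ) (hg' : (g' : X → D) = ⇑g ∘ iota hΩ) :
    WayBelow f g ↔ Prec Ω₀ D₀ f' g' := by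
  rw [wayBelow_iff_of_mem_BHat hD hD₀ hΩ hf, prec_iff, hf', hg']
  refine ⟨fun h x => h _, fun h y => ?_⟩
  obtain ⟨x, hfx, hgx⟩ := exists_iota_apply_eq hΩ hf hg y
  rw [← hfx, ← hgx]
  exact h x

end Main

end FunDom

theorem mainTheorem4 {X : Type*} [TopologicalSpace X]
    {D : Type*} [PartialOrder D] [OrderBot D]
    [TopologicalSpace D] [Topology.IsScott D Set.univ]
    (hD : FunDom.IsBCDomain D) (D₀ : Set D) (hD₀ : FunDom.IsDomBasis D₀)
    (Ω₀ : Set (Set X)) (hΩ : FunDom.IsViableBase Ω₀) :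
    -- the relation `≺` does not depend on the representation, and gives an abstract basis
    (∀ (f g : FunDom.BAbs Ω₀ D₀) (n : ℕ) (b : Fin n → D) (O : Fin n → Set X),
      FunDom.IsStepRep Ω₀ D₀ b O f →
        (FunDom.Prec Ω₀ D₀ f g ↔
          ∀ i, O i ⊆ (g : X → D) ⁻¹' {d | FunDom.WayBelow (b i) d})) ∧
    FunDom.IsAbstractBasis (FunDom.Prec Ω₀ D₀) ∧
    -- the function space on the spectral compactification is a domain with basis `BHat`
    FunDom.IsContDomain C(FunDom.Spect Ω₀, D) ∧
    FunDom.IsDomBasis (FunDom.BHat Ω₀ D₀) ∧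
    -- composition with `ι` is an isomorphism of abstract bases
    Set.BijOn (fun f : C(FunDom.Spect Ω₀, D) => ⇑f ∘ FunDom.iota hΩ)
      (FunDom.BHat Ω₀ D₀) (FunDom.BAbs Ω₀ D₀) ∧
    (∀ f ∈ FunDom.BHat Ω₀ D₀, ∀ g ∈ FunDom.BHat Ω₀ D₀, ∀ f' g' : FunDom.BAbs Ω₀ D₀,
      (f' : X → D) = ⇑f ∘ FunDom.iota hΩ → (g' : X → D) = ⇑g ∘ FunDom.iota hΩ →
        (FunDom.WayBelow f g ↔ FunDom.Prec Ω₀ D₀ f' g')) ∧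
    -- the induced order isomorphism with the rounded ideal completion
    ∃ e : FunDom.RoundedIdeal (FunDom.Prec Ω₀ D₀) ≃o C(FunDom.Spect Ω₀, D),
      ∀ I, IsLUB {f : C(FunDom.Spect Ω₀, D) | f ∈ FunDom.BHat Ω₀ D₀ ∧
        ∃ h : FunDom.BAbs Ω₀ D₀, h ∈ I.carrier ∧ (h : X → D) = ⇑f ∘ FunDom.iota hΩ} (e I) := by
  have hBij := FunDom.bijOn_comp_iota (D₀ := D₀) hD hΩ
  -- `k` inverts composition with `ι`; it presents `BHat` as a basis indexed by `BAbs`, as the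
  -- general completion results require.
  choose k hk hkγ using fun h : FunDom.BAbs Ω₀ D₀ => hBij.surjOn h.2
  have hrange : Set.range k = FunDom.BHat Ω₀ D₀ := by
    refine Set.Subset.antisymm (Set.range_subset_iff.2 hk) fun f hf => ?_
    exact ⟨⟨_, hBij.mapsTo hf⟩, hBij.injOn (hk _) hf (hkγ _)⟩
  have hBasis := FunDom.isDomBasis_BHat hD hD₀ hΩ
  have hBasis' : FunDom.IsDomBasis (Set.range k) := hrange ▸ hBasis
  have hr (a b) : FunDom.Prec Ω₀ D₀ a b ↔ FunDom.WayBelow (k a) (k b) :=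
    (FunDom.wayBelow_iff_prec hD hD₀ hΩ (hk a) (hk b) (hkγ a).symm (hkγ b).symm).symm
  have hdcpo : FunDom.IsDcpo C(FunDom.Spect Ω₀, D) :=
    FunDom.isDcpo_continuousMap hD.dcpo
  refine ⟨fun f g n b O hf => ?_, FunDom.isAbstractBasis_of_isDomBasis hBasis' hr,
    ⟨⟨ContinuousMap.const _ ⊥, fun f y => bot_le⟩, hdcpo, _, hBasis⟩, hBasis, hBij,
    fun f hf g hg f' g' hf' hg' => FunDom.wayBelow_iff_prec hD hD₀ hΩ hf hg hf' hg', ?_⟩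
  · rw [FunDom.prec_iff]
    exact FunDom.isLUB_steps_wayBelow_iff hf.isLUB
  · obtain ⟨e, he⟩ := FunDom.exists_roundedIdeal_orderIso hdcpo hBasis' hr
    refine ⟨e, fun I => ?_⟩
    convert! he I using 1
    ext f
    constructor
    · rintro ⟨hf, h, hI, hh⟩
      exact ⟨h, hI, hBij.injOn (hk h) hf ((hkγ h).trans hh)⟩
    · rintro ⟨h, hI, rfl⟩
      exact ⟨hk h, h, hI, (hkγ h).symm⟩
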